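/- Let $\mathcal S^p$ ($1\le p<\infty$) denote the Schatten class of bounded operators $A$ on $\ell^2$ with $\|A\|_p=\mathrm{Tr}(|A|^p)^{1/p}<\infty$, and let $\mathcal S^\infty$ denote the space of all compact operators on $\ell^2$ with the operator norm. Operators are regarded as infinite matrices $A=\{a_{ij}\}_{i,j\ge1}$ with respect to the standard basis, and $E_{ij}$ denotes the matrix units. A complex matrix $\{m_{ij}\}_{i,j\ge 1}$ is a *linear Schur multiplier on* $\mathcal S^\infty$ if $A\mapsto\sum_{i,j\ge1}m_{ij}a_{ij}E_{ij}$ defines a bounded linear operator from $\mathcal S^\infty$ to $\mathcal S^\infty$. A three-dimensional complex matrix $M=\{m_{ikj}\}_{i,k,j\ge1}$ is a *bilinear Schur multiplier into* $\mathcal S^1$ if $$M(A,B)=\sum_{i,j,k\ge1}m_{ikj}a_{ik}b_{kj}E_{ij},\qquad A=\{a_{ij}\},\ B=\{b_{ij}\}\in\mathcal S^2,$$ defines a bounded bilinear operator from $\mathcal S^2\times\mathcal S^2$ into $\mathcal S^1$. **Theorem.** A three-dimensional matrix $M=\{m_{ikj}\}_{i,k,j\ge1}$ is a bilinear Schur multiplier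 into $\mathcal S^1$ if and only if the matrix $M(k)=\{m_{ikj}\}_{i,j\ge1}$ is a linear Schur multiplier on $\mathcal S^\infty$ for every $k\ge1$ and $\sup_{k\ge1}\|M(k):\mathcal S^\infty\to\mathcal S^\infty\|<\infty$. Moreover, in this case, $$\bigl\|M:\mathcal S^2\times\mathcal S^2\to\mathcal S^1\bigr\|=\sup_{k\ge1}\bigl\|M(k):\mathcal S^\infty\to\mathcal S^\infty\bigr\|.$$ -/

import Mathlib

open scoped ENNReal InnerProductSpace

noncomputable section

namespace SchurMult

/-- The Hilbert space `ℓ²` of square-summable complex sequences (indexed by `ℕ`). -/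
abbrev EllTwo : Type := lp (fun _ : ℕ => ℂ) 2

/-- The algebra `B(ℓ²)` of bounded operators on `ℓ²`. -/
abbrev Op : Type := EllTwo →L[ℂ] EllTwo

/-- The standard basis vectors of `ℓ²`. -/
def stdVec (i : ℕ) : EllTwo := lp.single 2 i (1 : ℂ)

/-- The matrix entry `a_{ij} = ⟨A e_j, e_i⟩` of a bounded operator (Mathlib's inner product is
linear in the second variable). -/
def entry (A : Op) (i j : ℕ) : ℂ := ⟪stdVec i, A (stdVec j)⟫_ℂ

/-- The operator `|A|^p`, where `|A| = (A* A)^{1/2}`, on a complex Hilbert space, by the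
continuous functional calculus. -/
def absPow {H : Type*} [NormedAddCommGroup H] [InnerProductSpace ℂ H] [CompleteSpace H]
    (p : ℝ) (A : H →L[ℂ] H) : H →L[ℂ] H :=
  CFC.abs A ^ p

/-- `Tr(|A|^p) ∈ [0, ∞]`, the sum of the diagonal entries of `|A|^p`, which are nonnegative
reals. -/
def traceAbsPow (p : ℝ) (A : Op) : ℝ≥0∞ :=
  ∑' i : ℕ, ENNReal.ofReal (entry (absPow p A) i i).re

open Classical in
/-- Membership in the Schatten class `S^p`, `1 ≤ p ≤ ∞`: for `p < ∞` this means
`Tr(|A|^p) < ∞`, and `S^∞` is the space of compact operators. -/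
def MemSchatten (p : ℝ≥0∞) (A : Op) : Prop :=
  if p = ∞ then IsCompactOperator A else traceAbsPow p.toReal A < ∞

open Classical in
/-- The Schatten norm, for `1 ≤ p ≤ ∞` and `A ∈ S^p`: `Tr(|A|^p)^{1/p}` if `p < ∞`, and the
operator norm if `p = ∞`. -/
def schattenNorm (p : ℝ≥0∞) (A : Op) : ℝ :=
  if p = ∞ then ‖A‖ else (traceAbsPow p.toReal A).toReal ^ (1 / p.toReal)

/-- The action `A ↦ (m_{ij} a_{ij})_{ij}` is a well defined map from `S^p` to `S^p` with
`‖M(A)‖_p ≤ C ‖A‖_p` for all `A`. -/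
def IsLinearBound (p : ℝ≥0∞) (m : ℕ → ℕ → ℂ) (C : ℝ) : Prop :=
  0 ≤ C ∧ ∀ A : Op, MemSchatten p A → ∃ T : Op, MemSchatten p T ∧
    (∀ i j, entry T i j = m i j * entry A i j) ∧ schattenNorm p T ≤ C * schattenNorm p A

/-- `m` is a linear Schur multiplier on `S^p`. -/
def IsLinearSchurMultiplier (p : ℝ≥0∞) (m : ℕ → ℕ → ℂ) : Prop :=
  ∃ C, IsLinearBound p m C

/-- The operator norm `‖M : S^p → S^p‖` of a linear Schur multiplier: the least bound. -/
def linearSchurNorm (p : ℝ≥0∞) (m : ℕ → ℕ → ℂ) : ℝ :=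
  sInf {C | IsLinearBound p m C}

/-- The action `(A, B) ↦ (∑_k m_{ikj} a_{ik} b_{kj})_{ij}` is a well defined map from
`S² × S²` to `S^r` with `‖M(A, B)‖_r ≤ C ‖A‖₂ ‖B‖₂` for all `A`, `B`. The indices of `m` are
in the order `i`, `k`, `j`. -/
def IsBilinearBound (r : ℝ≥0∞) (m : ℕ → ℕ → ℕ → ℂ) (C : ℝ) : Prop :=
  0 ≤ C ∧ ∀ A B : Op, MemSchatten 2 A → MemSchatten 2 B → ∃ T : Op, MemSchatten r T ∧
    (∀ i j, HasSum (fun k => m i k j * entry A i k * entry B k j) (entry T i j)) ∧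
    schattenNorm r T ≤ C * schattenNorm 2 A * schattenNorm 2 B

/-- `m` is a bilinear Schur multiplier from `S² × S²` into `S^r`. -/
def IsBilinearSchurMultiplier (r : ℝ≥0∞) (m : ℕ → ℕ → ℕ → ℂ) : Prop :=
  ∃ C, IsBilinearBound r m C

/-- The norm `‖M : S² × S² → S^r‖` of a bilinear Schur multiplier: the least bound. -/
def bilinearSchurNorm (r : ℝ≥0∞) (m : ℕ → ℕ → ℕ → ℂ) : ℝ :=
  sInf {C | IsBilinearBound r m C}

end SchurMult

end

open Filter Topology ComplexConjugate

noncomputable section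

namespace SchurMult

/-! ### Coordinates and matrix entries -/

/-! The bilinear map decouples over the middle index: `M(A, B) = ∑ₖ M(k)(aₖ ⊗ bₖ)`, with `aₖ` the
`k`-th column of `A` and `bₖ` the `k`-th row of `B`. Cauchy–Schwarz gives `∑ₖ ‖aₖ‖ ‖bₖ‖ ≤ ‖A‖₂
‖B‖₂`, and rank one `A`, `B` supported on column `k` and row `k` isolate `M(k)`. So a bilinear bound
`C` amounts to each `M(k)` sending `x ⊗ y` to an operator of trace norm at most `C ‖x‖ ‖y‖`.

By trace duality this is the bound `C` on compact operators: pairing `M(k)(x ⊗ y)` with `W` is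
pairing `M(k)(Wᵗ)` with `x` and `y` (`norm_sum_inner_schur_rankOne_le`, `norm_schurCorner_le`). Both
halves of the duality, `norm_sum_inner_comp_le_traceNorm` and `traceAbsPow_one_le`, use finite
diagonal sums and an approximate polar decomposition. The constant never changes
(`isBilinearBound_one_iff`), hence the equality of norms. -/

theorem inner_stdVec_left (i : ℕ) (x : EllTwo) : ⟪stdVec i, x⟫_ℂ = x i := by
  simp [stdVec, lp.inner_single_left]

theorem inner_stdVec_right (i : ℕ) (x : EllTwo) : ⟪x, stdVec i⟫_ℂ = conj (x i) := by
  rw [← inner_conj_symm, inner_stdVec_left]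

theorem entry_eq (A : Op) (i j : ℕ) : entry A i j = A (stdVec j) i := inner_stdVec_left _ _

theorem stdVec_apply (i j : ℕ) : stdVec i j = if j = i then 1 else 0 := by
  simp [stdVec, lp.single_apply, Pi.single_apply]

theorem norm_stdVec (i : ℕ) : ‖stdVec i‖ = 1 := by
  simp [stdVec, lp.norm_single]

theorem hasSum_coord_smul_stdVec (x : EllTwo) : HasSum (fun i => x i • stdVec i) x := by
  have h := lp.hasSum_single (p := 2) (by simp) x
  refine h.congr_fun fun i => ?_
  simp [stdVec, ← lp.single_smul]

theorem inner_eq_tsum_coord (x y : EllTwo) : ⟪x, y⟫_ℂ = ∑' i, conj (x i) * y i := by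
  rw [lp.inner_eq_tsum]
  simp [RCLike.inner_apply, mul_comm]

theorem hasSum_norm_sq_coord (x : EllTwo) : HasSum (fun i => ‖x i‖ ^ 2) (‖x‖ ^ 2) := by
  simpa using lp.hasSum_norm (p := 2) (by simp) x

theorem op_ext_entry {S T : Op} (h : ∀ i j, entry S i j = entry T i j) : S = T := by
  have h1 : ∀ j, S (stdVec j) = T (stdVec j) := fun j => by
    ext i
    simpa [entry_eq] using h i j
  ext1 x
  have hS := (hasSum_coord_smul_stdVec x).mapL S
  have hT := (hasSum_coord_smul_stdVec x).mapL T
  refine hS.unique ?_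
  simpa [h1] using hT

theorem entry_adjoint (A : Op) (i j : ℕ) : entry (A.adjoint) i j = conj (entry A j i) := by
  rw [entry, ContinuousLinearMap.adjoint_inner_right, entry, inner_conj_symm]

theorem continuous_entry (i j : ℕ) : Continuous fun A : Op => entry A i j := by
  unfold entry
  fun_prop

theorem entry_rankOne (x y : EllTwo) (i j : ℕ) :
    entry (InnerProductSpace.rankOne ℂ x y) i j = x i * conj (y j) := by
  rw [entry, InnerProductSpace.rankOne_apply, inner_smul_right, inner_stdVec_left,
    inner_stdVec_right, mul_comm]

/-! ### The transpose of an operator -/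

/-- The operator whose matrix is the entrywise complex conjugate of that of `A`. -/
def conjOp (A : Op) : Op :=
  LinearMap.mkContinuous
    { toFun := fun x => star (A (star x))
      map_add' := fun x y => by simp
      map_smul' := fun c x => by simp [star_smul] } ‖A‖
    fun x => by simpa using A.le_opNorm (star x)

theorem conjOp_apply (A : Op) (x : EllTwo) : conjOp A x = star (A (star x)) := rfl

/-- The operator with the transposed matrix. -/
def transposeOp (A : Op) : Op := (conjOp A).adjoint

theorem entry_transposeOp (A : Op) (i j : ℕ) : entry (transposeOp A) i j = entry A j i := by
  have h : star (stdVec i) = stdVec i := by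
    ext k
    simp [lp.star_apply, stdVec_apply, apply_ite]
  rw [transposeOp, entry_adjoint, entry_eq, entry_eq, conjOp_apply, h, lp.star_apply]
  simp

theorem norm_transposeOp_le (A : Op) : ‖transposeOp A‖ ≤ ‖A‖ := by
  rw [transposeOp, LinearIsometryEquiv.norm_map]
  exact LinearMap.mkContinuous_norm_le _ (norm_nonneg _) _

/-! ### Coordinate projections -/

/-- The orthogonal projection onto the span of the first `n` basis vectors. -/
def coordProj (n : ℕ) : Op :=
  ∑ i ∈ Finset.range n, InnerProductSpace.rankOne ℂ (stdVec i) (stdVec i)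

theorem coordProj_eq_sum (n : ℕ) (x : EllTwo) :
    coordProj n x = ∑ i ∈ Finset.range n, x i • stdVec i := by
  simp [coordProj, inner_stdVec_left]

theorem coordProj_apply (n : ℕ) (x : EllTwo) (j : ℕ) :
    coordProj n x j = if j < n then x j else 0 := by
  rw [coordProj_eq_sum, lp.coeFn_sum, Finset.sum_apply]
  simp [stdVec_apply, lp.coeFn_smul]

theorem adjoint_coordProj (n : ℕ) : (coordProj n).adjoint = coordProj n := by
  simp [coordProj, map_sum]

theorem coordProj_stdVec (n j : ℕ) :
    coordProj n (stdVec j) = if j < n then stdVec j else 0 := by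
  ext k
  rw [coordProj_apply, stdVec_apply]
  split_ifs <;> simp [stdVec_apply] <;> omega

theorem norm_coordProj_apply_le (n : ℕ) (x : EllTwo) : ‖coordProj n x‖ ≤ ‖x‖ := by
  refine le_of_sq_le_sq ?_ (norm_nonneg _)
  refine hasSum_le (fun i => ?_) (hasSum_norm_sq_coord _) (hasSum_norm_sq_coord x)
  rw [coordProj_apply]
  split_ifs
  · rfl
  · simp

theorem norm_sub_coordProj_apply_le (n : ℕ) (x : EllTwo) : ‖x - coordProj n x‖ ≤ ‖x‖ := by
  refine le_of_sq_le_sq ?_ (norm_nonneg _)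
  refine hasSum_le (fun i => ?_) (hasSum_norm_sq_coord _) (hasSum_norm_sq_coord x)
  rw [lp.coeFn_sub, Pi.sub_apply, coordProj_apply]
  split_ifs <;> simp

theorem norm_coordProj_le (n : ℕ) : ‖coordProj n‖ ≤ 1 :=
  ContinuousLinearMap.opNorm_le_bound _ zero_le_one fun x => by
    simpa using norm_coordProj_apply_le n x

theorem norm_one_sub_coordProj_le (n : ℕ) : ‖1 - coordProj n‖ ≤ 1 :=
  ContinuousLinearMap.opNorm_le_bound _ zero_le_one fun x => by
    simpa using norm_sub_coordProj_apply_le n x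

theorem tendsto_coordProj_apply (x : EllTwo) :
    Tendsto (fun n => coordProj n x) atTop (𝓝 x) := by
  simpa only [coordProj_eq_sum] using (hasSum_coord_smul_stdVec x).tendsto_sum_nat

theorem entry_coordProj_mul (n : ℕ) (A : Op) (i j : ℕ) :
    entry (coordProj n ∘L A) i j = if i < n then entry A i j else 0 := by
  simp [entry_eq, coordProj_apply]

theorem entry_mul_coordProj (n : ℕ) (A : Op) (i j : ℕ) :
    entry (A ∘L coordProj n) i j = if j < n then entry A i j else 0 := by
  rw [entry_eq, ContinuousLinearMap.comp_apply, coordProj_stdVec]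
  split_ifs <;> simp [entry_eq]

/-! ### Compact operators -/

theorem isCompactOperator_rankOne (x y : EllTwo) :
    IsCompactOperator (InnerProductSpace.rankOne ℂ x y) := by
  have h := (isCompactOperator_of_locallyCompactSpace_rng
    (ContinuousLinearMap.toSpanSingleton ℂ x)).comp_clm (innerSL ℂ y)
  rw [InnerProductSpace.rankOne_def']
  exact h

theorem isCompactOperator_sum {ι : Type*} (s : Finset ι) (f : ι → Op)
    (h : ∀ i ∈ s, IsCompactOperator (f i)) : IsCompactOperator (∑ i ∈ s, f i : Op) :=
  (compactOperator (RingHom.id ℂ) EllTwo EllTwo).sum_mem h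

theorem isCompactOperator_coordProj (n : ℕ) : IsCompactOperator (coordProj n) :=
  isCompactOperator_sum _ _ fun _ _ => isCompactOperator_rankOne _ _

/-- Strong convergence of the projections is uniform on a finite `ε/3`-net of the image of the unit
ball, and `1 - coordProj n` is a contraction. -/
theorem tendsto_coordProj_comp {K : Op} (hK : IsCompactOperator K) :
    Tendsto (fun n => coordProj n ∘L K) atTop (𝓝 K) := by
  rw [Metric.tendsto_atTop]
  intro ε hε
  have hc := IsCompactOperator.isCompact_closure_image_closedBall
    (f := (K : EllTwo →ₗ[ℂ] EllTwo)) hK 1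
  obtain ⟨t, ht, hcover⟩ := Metric.totallyBounded_iff.1 hc.totallyBounded (ε / 3) (by positivity)
  have h1 : ∀ y ∈ t, ∀ᶠ n in atTop, ‖y - coordProj n y‖ < ε / 3 := fun y _ => by
    have := (tendsto_const_nhds (x := y)).sub (tendsto_coordProj_apply y)
    rw [sub_self] at this
    have := this.norm
    rw [norm_zero] at this
    exact this.eventually_lt_const (by positivity)
  obtain ⟨N, hN⟩ := eventually_atTop.1 ((ht.eventually_all).2 h1)
  refine ⟨N, fun n hn => ?_⟩
  rw [dist_eq_norm, norm_sub_rev]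
  refine lt_of_le_of_lt (ContinuousLinearMap.opNorm_le_of_unit_norm (C := 2 * ε / 3)
    (by positivity) fun x hx => ?_) (by linarith)
  have hx' : K x ∈ closure (K '' Metric.closedBall 0 1) :=
    subset_closure ⟨x, by simp [hx], rfl⟩
  obtain ⟨y, hy, hxy⟩ := Set.mem_iUnion₂.1 (hcover hx')
  rw [Metric.mem_ball, dist_eq_norm] at hxy
  have h2 := norm_sub_coordProj_apply_le n (K x - y)
  have h3 := hN n hn y hy
  have h4 : (K - coordProj n ∘L K) x = (K x - y - coordProj n (K x - y)) +
      (y - coordProj n y) := by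
    simp only [sub_apply, ContinuousLinearMap.comp_apply, map_sub]
    abel
  rw [h4]
  refine (norm_add_le _ _).trans ?_
  linarith

/-- The C*-identity reduces this to left multiplication of the compact operator `K* K`, so
compactness of `K*` is not needed. -/
theorem tendsto_comp_coordProj {K : Op} (hK : IsCompactOperator K) :
    Tendsto (fun n => K ∘L coordProj n) atTop (𝓝 K) := by
  have hKK : IsCompactOperator (K.adjoint ∘L K) := hK.clm_comp K.adjoint
  have h1 : Tendsto (fun n => ‖coordProj n ∘L (K.adjoint ∘L K) - K.adjoint ∘L K‖) atTop (𝓝 0) :=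
    tendsto_iff_norm_sub_tendsto_zero.1 (tendsto_coordProj_comp hKK)
  rw [tendsto_iff_norm_sub_tendsto_zero]
  have h2 : Tendsto (fun n => √‖coordProj n ∘L (K.adjoint ∘L K) - K.adjoint ∘L K‖)
      atTop (𝓝 0) := by simpa using h1.sqrt
  refine squeeze_zero (fun _ => norm_nonneg _) (fun n => ?_) h2
  refine Real.le_sqrt_of_sq_le ?_
  have h3 : (K ∘L coordProj n - K).adjoint ∘L (K ∘L coordProj n - K) =
      (coordProj n ∘L (K.adjoint ∘L K) - K.adjoint ∘L K) ∘L (coordProj n - 1) := by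
    rw [map_sub, ContinuousLinearMap.adjoint_comp, adjoint_coordProj]
    ext1 x
    simp
  rw [sq, ← ContinuousLinearMap.norm_adjoint_comp_self, h3]
  refine (ContinuousLinearMap.opNorm_comp_le _ _).trans ?_
  rw [norm_sub_rev (coordProj n)]
  exact mul_le_of_le_one_right (norm_nonneg _) (norm_one_sub_coordProj_le n)

/-- The upper left `n × n` corner of an operator. -/
def corner (n : ℕ) (A : Op) : Op := coordProj n ∘L A ∘L coordProj n

theorem tendsto_corner {K : Op} (hK : IsCompactOperator K) :
    Tendsto (fun n => corner n K) atTop (𝓝 K) := by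
  have h1 := tendsto_iff_norm_sub_tendsto_zero.1 (tendsto_coordProj_comp hK)
  have h2 := tendsto_iff_norm_sub_tendsto_zero.1 (tendsto_comp_coordProj hK)
  rw [tendsto_iff_norm_sub_tendsto_zero]
  refine squeeze_zero (fun _ => norm_nonneg _) (fun n => ?_) (by simpa using h2.add h1)
  have h3 : corner n K - K =
      coordProj n ∘L (K ∘L coordProj n - K) + (coordProj n ∘L K - K) := by
    ext1 x
    simp [corner]
  rw [h3]
  refine (norm_add_le _ _).trans (add_le_add_left ?_ _)
  refine (ContinuousLinearMap.opNorm_comp_le _ _).trans ?_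
  exact mul_le_of_le_one_left (norm_nonneg _) (norm_coordProj_le n)

theorem entry_corner (n : ℕ) (A : Op) (i j : ℕ) :
    entry (corner n A) i j = if i < n ∧ j < n then entry A i j else 0 := by
  rw [corner, entry_coordProj_mul, entry_mul_coordProj]
  split_ifs <;> simp_all

/-! ### The Hilbert–Schmidt norm -/

/-- The square of the Hilbert–Schmidt norm. -/
def hsSq (A : Op) : ℝ≥0∞ := ∑' i, ENNReal.ofReal (‖A (stdVec i)‖ ^ 2)

theorem hsSq_eq_tsum_tsum (A : Op) :
    hsSq A = ∑' j, ∑' i, ENNReal.ofReal (‖entry A i j‖ ^ 2) := by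
  refine tsum_congr fun j => ?_
  have h := hasSum_norm_sq_coord (A (stdVec j))
  rw [← h.tsum_eq, ENNReal.ofReal_tsum_of_nonneg (fun _ => by positivity) h.summable]
  simp [entry_eq]

theorem hsSq_adjoint (A : Op) : hsSq A.adjoint = hsSq A := by
  rw [hsSq_eq_tsum_tsum, hsSq_eq_tsum_tsum, ENNReal.tsum_comm]
  simp [entry_adjoint]

theorem hsSq_comp_le (X A : Op) : hsSq (X ∘L A) ≤ ENNReal.ofReal (‖X‖ ^ 2) * hsSq A := by
  rw [hsSq, hsSq, ← ENNReal.tsum_mul_left]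
  refine ENNReal.tsum_le_tsum fun i => ?_
  rw [← ENNReal.ofReal_mul (by positivity), ← mul_pow]
  gcongr
  exact X.le_opNorm _

theorem hsSq_comp_le_right (A X : Op) : hsSq (A ∘L X) ≤ ENNReal.ofReal (‖X‖ ^ 2) * hsSq A := by
  rw [← hsSq_adjoint, ← hsSq_adjoint A, ContinuousLinearMap.adjoint_comp]
  simpa using hsSq_comp_le X.adjoint A.adjoint

theorem summable_norm_sq_of_hsSq_lt_top {A : Op} (h : hsSq A < ∞) :
    Summable fun i => ‖A (stdVec i)‖ ^ 2 := by
  simpa using ENNReal.summable_toReal h.ne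

theorem toReal_hsSq (A : Op) : (hsSq A).toReal = ∑' i, ‖A (stdVec i)‖ ^ 2 := by
  rw [hsSq, ENNReal.tsum_toReal_eq fun _ => ENNReal.ofReal_ne_top]
  simp

theorem sum_norm_mul_norm_le {A B : Op} (hA : hsSq A < ∞) (hB : hsSq B < ∞) (s : Finset ℕ) :
    ∑ i ∈ s, ‖A (stdVec i)‖ * ‖B (stdVec i)‖ ≤ √(hsSq A).toReal * √(hsSq B).toReal := by
  refine (Real.sum_mul_le_sqrt_mul_sqrt s _ _).trans ?_
  rw [toReal_hsSq, toReal_hsSq]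
  gcongr
  · exact (summable_norm_sq_of_hsSq_lt_top hA).sum_le_tsum _ fun _ _ => by positivity
  · exact (summable_norm_sq_of_hsSq_lt_top hB).sum_le_tsum _ fun _ _ => by positivity

theorem hsSq_rankOne (x y : EllTwo) :
    hsSq (InnerProductSpace.rankOne ℂ x y) = ENNReal.ofReal ((‖x‖ * ‖y‖) ^ 2) := by
  have h := (hasSum_norm_sq_coord y).mul_left (‖x‖ ^ 2)
  rw [mul_pow, ← h.tsum_eq, ENNReal.ofReal_tsum_of_nonneg (fun _ => by positivity) h.summable, hsSq]
  refine tsum_congr fun i => ?_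
  rw [InnerProductSpace.rankOne_apply, norm_smul, inner_stdVec_right, mul_pow, RCLike.norm_conj,
    mul_comm]

/-! ### The absolute value of an operator -/

section AbsoluteValue

variable {H : Type*} [NormedAddCommGroup H] [InnerProductSpace ℂ H] [CompleteSpace H]

theorem absPow_one (A : H →L[ℂ] H) : absPow 1 A = CFC.abs A :=
  CFC.rpow_one _ (CFC.abs_nonneg A)

theorem absPow_two (A : H →L[ℂ] H) : absPow 2 A = A.adjoint ∘L A := by
  have h := CFC.rpow_natCast (CFC.abs A) 2 (CFC.abs_nonneg A)
  rw [absPow]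
  norm_num at h
  rw [h, CFC.abs_sq]
  rfl

theorem absPow_one_comp_self (A : H →L[ℂ] H) :
    absPow 1 A ∘L absPow 1 A = A.adjoint ∘L A := by
  rw [absPow_one]
  exact CFC.abs_mul_abs A

theorem isPositive_absPow_one (A : H →L[ℂ] H) : (absPow 1 A).IsPositive := by
  rw [absPow_one]
  exact (ContinuousLinearMap.nonneg_iff_isPositive _).1 (CFC.abs_nonneg A)

/-- When `T` is trace class, `S` is Hilbert–Schmidt, which opens the way to Cauchy–Schwarz. -/
theorem exists_comp_self_eq_absPow_one (T : H →L[ℂ] H) :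
    ∃ S : H →L[ℂ] H, S.adjoint = S ∧ S ∘L S = absPow 1 T := by
  rw [absPow_one]
  exact ⟨CFC.sqrt (CFC.abs T), (CFC.sqrt_nonneg (CFC.abs T)).isSelfAdjoint.adjoint_eq,
    CFC.sqrt_mul_sqrt_self _ (CFC.abs_nonneg T)⟩

theorem norm_absPow_one_apply (T : H →L[ℂ] H) (x : H) : ‖absPow 1 T x‖ = ‖T x‖ := by
  have h1 : ⟪absPow 1 T x, absPow 1 T x⟫_ℂ = ⟪T x, T x⟫_ℂ := by
    rw [← ContinuousLinearMap.adjoint_inner_right,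
      (isPositive_absPow_one T).isSelfAdjoint.adjoint_eq, ← ContinuousLinearMap.comp_apply,
      absPow_one_comp_self, ContinuousLinearMap.comp_apply,
      ContinuousLinearMap.adjoint_inner_right]
  rw [inner_self_eq_norm_sq_to_K, inner_self_eq_norm_sq_to_K] at h1
  exact (sq_eq_sq₀ (norm_nonneg _) (norm_nonneg _)).1 (by exact_mod_cast h1)

/-- An approximate polar decomposition. -/
theorem exists_approx_polar (T : H →L[ℂ] H) {ε : ℝ} (hε : 0 < ε) :
    ∃ U : H →L[ℂ] H, ‖U‖ ≤ 1 ∧ ‖T - U ∘L absPow 1 T‖ ≤ ε ∧ ‖absPow 1 T - U.adjoint ∘L T‖ ≤ ε := by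
  set P : H →L[ℂ] H := absPow 1 T 
  have hP : P.IsPositive := isPositive_absPow_one T
  have hPadj : P.adjoint = P := hP.isSelfAdjoint.adjoint_eq
  have hPP : P ∘L P = T.adjoint ∘L T := absPow_one_comp_self T
  have hre : ∀ x, 0 ≤ RCLike.re ⟪P x, x⟫_ℂ := hP.re_inner_nonneg_left
  obtain ⟨e, he⟩ : ∃ e : ℂ, e = ε := ⟨_, rfl⟩
  have hconj : conj e = e := by rw [he, Complex.conj_ofReal]
  have hnorm : ‖e‖ = ε := by rw [he, Complex.norm_real, Real.norm_eq_abs, abs_of_pos hε]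
  have hmul : ∀ z : ℂ, RCLike.re (e * z) = ε * RCLike.re z := fun z => by
    rw [he]
    exact Complex.re_ofReal_mul ε z
  -- The regularization `|T| + ε` is invertible, and `U = T (|T| + ε)⁻¹` replaces the polar partial
  -- isometry.
  set Q : H →L[ℂ] H := P + e • 1 with hQ
  have hQx : ∀ x, ‖Q x‖ ^ 2 = ‖P x‖ ^ 2 + 2 * (ε * RCLike.re ⟪P x, x⟫_ℂ) + ε ^ 2 * ‖x‖ ^ 2 := by
    intro x
    have : Q x = P x + e • x := by simp [hQ]
    rw [this, @norm_add_sq ℂ, inner_smul_right, norm_smul, mul_pow, hmul, hnorm]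
  have hPQ : ∀ x, ‖P x‖ ≤ ‖Q x‖ := fun x => by
    refine le_of_sq_le_sq ?_ (norm_nonneg _)
    have := hre x
    rw [hQx]
    nlinarith [mul_nonneg hε.le this, mul_nonneg (sq_nonneg ε) (sq_nonneg ‖x‖)]
  have hunit : IsUnit Q := by
    refine ContinuousLinearMap.isUnit_of_forall_le_norm_inner_map Q (c := ε.toNNReal)
      (by simpa using hε) fun x => ?_
    refine le_trans ?_ (RCLike.re_le_norm _)
    have h1 : Q x = P x + e • x := by simp [hQ]
    have h2 : RCLike.re ⟪x, x⟫_ℂ = ‖x‖ ^ 2 := inner_self_eq_norm_sq x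
    rw [h1, inner_add_left, inner_smul_left, map_add, hconj, hmul, h2,
      Real.coe_toNNReal _ hε.le]
    linarith [hre x]
  obtain ⟨u, hu⟩ := hunit
  set R : H →L[ℂ] H := ↑u⁻¹ with hR
  have hQR : ∀ x, Q (R x) = x := fun x => by
    have : Q * R = 1 := by rw [← hu]; exact u.mul_inv
    exact congrArg (fun A : H →L[ℂ] H => A x) this
  have hRQ : ∀ x, R (Q x) = x := fun x => by
    have : R * Q = 1 := by rw [← hu]; exact u.inv_mul
    exact congrArg (fun A : H →L[ℂ] H => A x) this
  have hPR : ∀ x, ‖P (R x)‖ ≤ ‖x‖ := fun x => by simpa [hQR] using hPQ (R x)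
  have hTR : ∀ x, ‖T (R x)‖ ≤ ‖x‖ := fun x => by
    rw [← norm_absPow_one_apply]
    exact hPR x
  have hQadj : Q.adjoint = Q := by
    ext1 x
    refine ext_inner_left ℂ fun y => ?_
    rw [ContinuousLinearMap.adjoint_inner_right]
    simp [hQ, inner_add_left, inner_add_right, inner_smul_left, inner_smul_right,
      hP.inner_left_eq_inner_right, hconj]
  have hRadj : R.adjoint = R := by
    ext1 x
    refine ext_inner_left ℂ fun y => ?_
    rw [ContinuousLinearMap.adjoint_inner_right]
    conv_lhs => rw [← hQR x]
    conv_rhs => rw [← hQR y]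
    rw [← ContinuousLinearMap.adjoint_inner_left, hQadj]
  refine ⟨T ∘L R, ContinuousLinearMap.opNorm_le_bound _ zero_le_one fun x => ?_, ?_, ?_⟩
  · simpa using hTR x
  · refine ContinuousLinearMap.opNorm_le_bound _ hε.le fun x => ?_
    -- `T - T R P = T R (Q - P)` and `Q - P = ε`.
    have : (T - (T ∘L R) ∘L P) x = e • T (R x) := by
      have h1 : T x = T (R (P x + e • x)) := by
        conv_lhs => rw [← hRQ x]
        simp [hQ]
      simp only [sub_apply, ContinuousLinearMap.comp_apply]
      rw [h1]
      simp
    rw [this, norm_smul]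
    rw [hnorm]
    gcongr
    exact hTR x
  · have h : P - (T ∘L R).adjoint ∘L T = (e • (P ∘L R)).adjoint := by
      ext1 x
      have h1 : P x = R (P (P x) + e • P x) := by
        conv_lhs => rw [← hRQ (P x)]
        simp [hQ]
      have h2 : P (P x) = T.adjoint (T x) := congrArg (fun A : H →L[ℂ] H => A x) hPP
      rw [ContinuousLinearMap.adjoint_comp, hRadj]
      simp only [sub_apply, ContinuousLinearMap.comp_apply]
      rw [h1, h2, LinearIsometryEquiv.map_smulₛₗ, ContinuousLinearMap.adjoint_comp, hRadj, hPadj,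
        hconj]
      simp
    rw [h, LinearIsometryEquiv.norm_map, norm_smul]
    rw [hnorm]
    refine mul_le_of_le_one_right hε.le ?_
    exact ContinuousLinearMap.opNorm_le_bound _ zero_le_one fun x => by simpa using hPR x

end AbsoluteValue

/-! ### Schatten norms for `p = 1, 2, ∞` -/

theorem re_entry_adjoint_comp_self (A : Op) (i : ℕ) :
    (entry (A.adjoint ∘L A) i i).re = ‖A (stdVec i)‖ ^ 2 := by
  rw [entry, ContinuousLinearMap.comp_apply, ContinuousLinearMap.adjoint_inner_right]
  exact inner_self_eq_norm_sq (𝕜 := ℂ) _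

theorem traceAbsPow_two (A : Op) : traceAbsPow 2 A = hsSq A := by
  simp only [traceAbsPow, absPow_two, re_entry_adjoint_comp_self, hsSq]

theorem memSchatten_two_iff {A : Op} : MemSchatten 2 A ↔ hsSq A < ∞ := by
  simp [MemSchatten, traceAbsPow_two]

theorem schattenNorm_two (A : Op) : schattenNorm 2 A = √(hsSq A).toReal := by
  simp [schattenNorm, traceAbsPow_two, Real.sqrt_eq_rpow]

theorem memSchatten_one_iff {A : Op} : MemSchatten 1 A ↔ traceAbsPow 1 A < ∞ := by
  simp [MemSchatten]

theorem schattenNorm_one (A : Op) : schattenNorm 1 A = (traceAbsPow 1 A).toReal := by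
  simp [schattenNorm]

theorem memSchatten_top_iff {A : Op} : MemSchatten ∞ A ↔ IsCompactOperator A := by
  simp [MemSchatten]

theorem schattenNorm_top (A : Op) : schattenNorm ∞ A = ‖A‖ := by
  simp [schattenNorm]

/-! ### Duality between the trace norm and the operator norm -/

theorem le_of_forall_pos_le_add_mul {a b c : ℝ} (h : ∀ ε : ℝ, 0 < ε → a ≤ b + c * ε) : a ≤ b := by
  have h1 : Tendsto (fun ε : ℝ => b + c * ε) (𝓝[>] 0) (𝓝 (b + c * 0)) :=
    (Continuous.tendsto (by fun_prop) _).mono_left nhdsWithin_le_nhds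
  rw [mul_zero, add_zero] at h1
  exact ge_of_tendsto h1 (eventually_mem_nhdsWithin.mono h)

theorem norm_inner_stdVec_apply_le (A : Op) (i : ℕ) : ‖⟪stdVec i, A (stdVec i)⟫_ℂ‖ ≤ ‖A‖ := by
  refine (norm_inner_le_norm _ _).trans ?_
  simpa [norm_stdVec] using A.le_opNorm (stdVec i)

/-- A partial sum of the diagonal of `A` is at most `n ‖A‖`. -/
theorem norm_sum_inner_stdVec_le (A : Op) (n : ℕ) :
    ‖∑ i ∈ Finset.range n, ⟪stdVec i, A (stdVec i)⟫_ℂ‖ ≤ n * ‖A‖ := by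
  refine (norm_sum_le_of_le _ fun i _ => norm_inner_stdVec_apply_le A i).trans ?_
  simp

theorem sqrt_toReal_hsSq_comp_le {S X : Op} {c : ℝ} (hX : ‖X‖ ≤ c) (hS : hsSq S < ∞) :
    hsSq (S ∘L X) < ∞ ∧ √(hsSq (S ∘L X)).toReal ≤ c * √(hsSq S).toReal := by
  have hlt : ENNReal.ofReal (‖X‖ ^ 2) * hsSq S < ∞ := ENNReal.mul_lt_top ENNReal.ofReal_lt_top hS
  have hc : 0 ≤ c := (norm_nonneg X).trans hX
  refine ⟨(hsSq_comp_le_right S X).trans_lt hlt, ?_⟩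
  have h := ENNReal.toReal_mono hlt.ne (hsSq_comp_le_right S X)
  rw [ENNReal.toReal_mul, ENNReal.toReal_ofReal (by positivity)] at h
  calc √(hsSq (S ∘L X)).toReal ≤ √(‖X‖ ^ 2 * (hsSq S).toReal) := Real.sqrt_le_sqrt h
    _ = ‖X‖ * √(hsSq S).toReal := by
      rw [Real.sqrt_mul (by positivity), Real.sqrt_sq (norm_nonneg _)]
    _ ≤ c * √(hsSq S).toReal := by gcongr

/-- With `T ≈ U S S`, the sum is nearly a partial Hilbert–Schmidt pairing of `S U*` with `S X`. The
error is at most `n ‖X‖ ε`, which vanishes as `ε → 0` because `n` is fixed. -/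
theorem norm_sum_inner_comp_le_traceNorm {T : Op} (hT : traceAbsPow 1 T < ∞) (X : Op) (n : ℕ) :
    ‖∑ i ∈ Finset.range n, ⟪stdVec i, T (X (stdVec i))⟫_ℂ‖ ≤ (traceAbsPow 1 T).toReal * ‖X‖ := by
  obtain ⟨S, hSadj, hSS⟩ := exists_comp_self_eq_absPow_one T
  have hS : hsSq S = traceAbsPow 1 T := by
    simp only [traceAbsPow, hsSq, ← re_entry_adjoint_comp_self, hSadj, hSS]
  rw [← hS] at hT ⊢
  refine le_of_forall_pos_le_add_mul (c := n * ‖X‖) fun ε hε => ?_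
  obtain ⟨U, hU, hTU, -⟩ := exists_approx_polar T hε
  have h1 : ∀ i, ⟪stdVec i, T (X (stdVec i))⟫_ℂ =
      ⟪(S ∘L U.adjoint) (stdVec i), (S ∘L X) (stdVec i)⟫_ℂ +
        ⟪stdVec i, ((T - U ∘L absPow 1 T) ∘L X) (stdVec i)⟫_ℂ := fun i => by
    have h2 : ⟪(S ∘L U.adjoint) (stdVec i), (S ∘L X) (stdVec i)⟫_ℂ =
        ⟪stdVec i, (U ∘L absPow 1 T) (X (stdVec i))⟫_ℂ := by
      rw [← hSS]
      simp only [ContinuousLinearMap.comp_apply]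
      rw [← ContinuousLinearMap.adjoint_inner_right, hSadj,
        ContinuousLinearMap.adjoint_inner_left]
    rw [h2, ← inner_add_right]
    simp
  simp only [h1, Finset.sum_add_distrib]
  refine (norm_add_le _ _).trans (add_le_add ?_ ?_)
  · obtain ⟨hA, hA'⟩ := sqrt_toReal_hsSq_comp_le (X := U.adjoint) (c := 1) (by simpa using hU) hT
    obtain ⟨hB, hB'⟩ := sqrt_toReal_hsSq_comp_le (X := X) le_rfl hT
    refine (norm_sum_le_of_le _ fun i _ => norm_inner_le_norm _ _).trans ?_
    refine (sum_norm_mul_norm_le hA hB _).trans ?_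
    calc _ ≤ (1 * √(hsSq S).toReal) * (‖X‖ * √(hsSq S).toReal) := by gcongr
      _ = √(hsSq S).toReal * √(hsSq S).toReal * ‖X‖ := by ring
      _ = _ := by rw [Real.mul_self_sqrt ENNReal.toReal_nonneg]
  · refine (norm_sum_inner_stdVec_le _ n).trans ?_
    rw [mul_assoc, mul_comm ‖X‖]
    gcongr
    exact (ContinuousLinearMap.opNorm_comp_le _ _).trans (by gcongr)

/-- The contraction `W = U*` nearly attains the trace norm, since `|T| ≈ U* T`. -/
theorem traceAbsPow_one_le {T : Op} {K : ℝ}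
    (h : ∀ W : Op, ‖W‖ ≤ 1 → ∀ n,
      ‖∑ i ∈ Finset.range n, ⟪stdVec i, W (T (stdVec i))⟫_ℂ‖ ≤ K) :
    traceAbsPow 1 T ≤ ENNReal.ofReal K := by
  refine ENNReal.tsum_le_of_sum_range_le fun n => ?_
  have h0 : ∀ i, 0 ≤ (entry (absPow 1 T) i i).re := fun i =>
    (isPositive_absPow_one T).re_inner_nonneg_right (stdVec i)
  rw [← ENNReal.ofReal_sum_of_nonneg fun i _ => h0 i]
  refine ENNReal.ofReal_le_ofReal (le_of_forall_pos_le_add_mul (c := n) fun ε hε => ?_)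
  obtain ⟨U, hU, -, hU'⟩ := exists_approx_polar T hε
  have h1 : ∀ i, entry (absPow 1 T) i i = ⟪stdVec i, U.adjoint (T (stdVec i))⟫_ℂ +
      ⟪stdVec i, (absPow 1 T - U.adjoint ∘L T) (stdVec i)⟫_ℂ := fun i => by
    rw [entry, ← inner_add_right]
    simp
  rw [← Complex.re_sum]
  simp only [h1, Finset.sum_add_distrib]
  refine (Complex.re_le_norm _).trans ((norm_add_le _ _).trans (add_le_add ?_ ?_))
  · exact h _ (by simpa using hU) n
  · exact (norm_sum_inner_stdVec_le _ n).trans (by gcongr)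

/-! ### From linear to bilinear multipliers -/

theorem norm_sum_inner_schur_rankOne_le {m : ℕ → ℕ → ℂ} {C : ℝ} (h : IsLinearBound ∞ m C)
    {a b : EllTwo} {T : Op} (hT : ∀ i j, entry T i j = m i j * (a i * conj (b j)))
    {W : Op} (hW : ‖W‖ ≤ 1) (n : ℕ) :
    ‖∑ i ∈ Finset.range n, ⟪stdVec i, W (T (stdVec i))⟫_ℂ‖ ≤ C * (‖a‖ * ‖b‖) := by
  -- Truncation makes the transpose compact, so the multiplier applies; only columns `i < n` enter
  -- the sum.
  have hX : IsCompactOperator (transposeOp W ∘L coordProj n) :=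
    (isCompactOperator_coordProj n).clm_comp (transposeOp W)
  obtain ⟨Y, -, hYe, hY⟩ := h.2 _ (memSchatten_top_iff.2 hX)
  rw [schattenNorm_top, schattenNorm_top] at hY
  have hY1 : ‖Y‖ ≤ C := by
    refine hY.trans (mul_le_of_le_one_right h.1 ?_)
    refine (ContinuousLinearMap.opNorm_comp_le _ _).trans ?_
    exact mul_le_one₀ ((norm_transposeOp_le W).trans hW) (norm_nonneg _) (norm_coordProj_le n)
  have key : ∑ i ∈ Finset.range n, ⟪stdVec i, W (T (stdVec i))⟫_ℂ =
      ⟪star a, Y (coordProj n (star b))⟫_ℂ := by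
    rw [coordProj_eq_sum, map_sum, inner_sum]
    refine Finset.sum_congr rfl fun i hi => ?_
    rw [map_smul, inner_smul_right, ← ContinuousLinearMap.adjoint_inner_left,
      inner_eq_tsum_coord, inner_eq_tsum_coord, ← tsum_mul_left]
    refine tsum_congr fun l => ?_
    rw [← entry_eq, ← entry_eq, ← entry_eq, entry_adjoint, hT, hYe, entry_mul_coordProj,
      if_pos (Finset.mem_range.1 hi), entry_transposeOp, lp.star_apply, lp.star_apply]
    simp
    ring
  rw [key]
  calc _ ≤ ‖star a‖ * ‖Y (coordProj n (star b))‖ := norm_inner_le_norm _ _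
    _ ≤ ‖star a‖ * (C * ‖star b‖) := by
      gcongr
      refine (Y.le_opNorm _).trans ?_
      gcongr
      · exact h.1
      · exact norm_coordProj_apply_le _ _
    _ = C * (‖a‖ * ‖b‖) := by
      rw [norm_star, norm_star]
      ring

theorem isBilinearBound_of_isLinearBound {m : ℕ → ℕ → ℕ → ℂ} {C : ℝ} (hC : 0 ≤ C)
    (h : ∀ k, IsLinearBound ∞ (fun i j => m i k j) C) : IsBilinearBound 1 m C := by
  refine ⟨hC, fun A B hA hB => ?_⟩
  rw [memSchatten_two_iff] at hA hB
  rw [schattenNorm_two, schattenNorm_two]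
  have hB' : hsSq B.adjoint < ∞ := by rwa [hsSq_adjoint]
  choose T _ hTe hTn using fun k => (h k).2 (InnerProductSpace.rankOne ℂ (A (stdVec k))
    (B.adjoint (stdVec k))) (memSchatten_top_iff.2 (isCompactOperator_rankOne _ _))
  simp only [schattenNorm_top, InnerProductSpace.norm_rankOne] at hTn
  simp only [entry_rankOne] at hTe
  have hpartial := sum_norm_mul_norm_le hA hB'
  rw [hsSq_adjoint] at hpartial
  have hsummable : Summable fun k => ‖A (stdVec k)‖ * ‖B.adjoint (stdVec k)‖ :=
    summable_of_sum_le (fun k => by positivity) hpartial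
  have hle : ∑' k, ‖A (stdVec k)‖ * ‖B.adjoint (stdVec k)‖ ≤
      √(hsSq A).toReal * √(hsSq B).toReal := hsummable.tsum_le_of_sum_le hpartial
  -- The series is summed in operator norm; the trace norm of its sum is then bounded by duality.
  obtain ⟨S, hS⟩ : Summable T := (hsummable.mul_left C).of_norm_bounded hTn
  have htrace : traceAbsPow 1 S ≤
      ENNReal.ofReal (C * √(hsSq A).toReal * √(hsSq B).toReal) := by
    refine traceAbsPow_one_le fun W hW n => ?_
    have h1 : HasSum (fun k => ∑ i ∈ Finset.range n, ⟪stdVec i, W (T k (stdVec i))⟫_ℂ)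
        (∑ i ∈ Finset.range n, ⟪stdVec i, W (S (stdVec i))⟫_ℂ) :=
      hasSum_sum fun i _ => ((hS.mapL (ContinuousLinearMap.apply ℂ EllTwo (stdVec i))).mapL
        W).mapL (innerSL ℂ (stdVec i))
    refine (h1.norm_le_of_bounded (hsummable.hasSum.mul_left C) fun k =>
      norm_sum_inner_schur_rankOne_le (h k) (hTe k) hW n).trans ?_
    rw [mul_assoc]
    gcongr
  refine ⟨S, memSchatten_one_iff.2 (htrace.trans_lt ENNReal.ofReal_lt_top), fun i j => ?_, ?_⟩
  · have h1 : HasSum (fun k => entry (T k) i j) (entry S i j) :=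
      (hS.mapL (ContinuousLinearMap.apply ℂ EllTwo (stdVec j))).mapL (innerSL ℂ (stdVec i))
    refine h1.congr_fun fun k => ?_
    rw [hTe, ← entry_eq, ← entry_eq, entry_adjoint, Complex.conj_conj, mul_assoc]
  · rw [schattenNorm_one]
    exact ENNReal.toReal_le_of_le_ofReal (by positivity) htrace

/-! ### From bilinear to linear multipliers -/

/-- The Schur product of `m` with the upper left `n × n` corner of `Y`. -/
def schurCorner (m : ℕ → ℕ → ℂ) (n : ℕ) (Y : Op) : Op :=
  ∑ i ∈ Finset.range n, ∑ j ∈ Finset.range n,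
    (m i j * entry Y i j) • InnerProductSpace.rankOne ℂ (stdVec i) (stdVec j)

theorem inner_schurCorner (m : ℕ → ℕ → ℂ) (n : ℕ) (Y : Op) (x y : EllTwo) :
    ⟪y, schurCorner m n Y x⟫_ℂ = ∑ i ∈ Finset.range n, ∑ j ∈ Finset.range n,
      m i j * entry Y i j * (x j * conj (y i)) := by
  simp [schurCorner, inner_stdVec_left, inner_stdVec_right]

theorem entry_schurCorner (m : ℕ → ℕ → ℂ) (n : ℕ) (Y : Op) (i j : ℕ) :
    entry (schurCorner m n Y) i j = if i < n ∧ j < n then m i j * entry Y i j else 0 := by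
  rw [entry, inner_schurCorner]
  simp [stdVec_apply, apply_ite (starRingEnd ℂ), ite_and]

theorem isCompactOperator_schurCorner (m : ℕ → ℕ → ℂ) (n : ℕ) (Y : Op) :
    IsCompactOperator (schurCorner m n Y) :=
  isCompactOperator_sum _ _ fun _ _ => isCompactOperator_sum _ _ fun _ _ =>
    IsCompactOperator.smul (isCompactOperator_rankOne _ _) (_ : ℂ)

/-- `m` maps rank one operators into the trace class with bound `C`. -/
def IsRankOneTraceBound (m : ℕ → ℕ → ℂ) (C : ℝ) : Prop :=
  ∀ x y : EllTwo, ∃ T : Op, traceAbsPow 1 T < ∞ ∧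
    (∀ i j, entry T i j = m i j * (x i * y j)) ∧ (traceAbsPow 1 T).toReal ≤ C * ‖x‖ * ‖y‖

/-- The sesquilinear form of the corner at `x`, `y` is a trace pairing of the image of the rank one
matrix `(conj yᵢ xⱼ)` with a truncated transpose of `Y`. -/
theorem norm_schurCorner_le {m : ℕ → ℕ → ℂ} {C : ℝ} (hC : 0 ≤ C) (h : IsRankOneTraceBound m C)
    (n : ℕ) (Y : Op) : ‖schurCorner m n Y‖ ≤ C * ‖Y‖ := by
  have key : ∀ x y : EllTwo, ‖⟪y, schurCorner m n Y x⟫_ℂ‖ ≤ C * ‖y‖ * ‖x‖ * ‖Y‖ := fun x y => by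
    obtain ⟨T, hT, hTe, hTn⟩ := h (star y) x
    rw [norm_star] at hTn
    have h1 : ⟪y, schurCorner m n Y x⟫_ℂ = ∑ i ∈ Finset.range n,
        ⟪stdVec i, T ((coordProj n ∘L transposeOp Y) (stdVec i))⟫_ℂ := by
      rw [inner_schurCorner]
      refine Finset.sum_congr rfl fun i _ => ?_
      rw [ContinuousLinearMap.comp_apply, coordProj_eq_sum, map_sum, inner_sum]
      refine Finset.sum_congr rfl fun j _ => ?_
      rw [map_smul, inner_smul_right, ← entry_eq, entry_transposeOp, ← entry, hTe, lp.star_apply]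
      simp
      ring
    rw [h1]
    refine (norm_sum_inner_comp_le_traceNorm hT _ n).trans ?_
    gcongr
    refine (ContinuousLinearMap.opNorm_comp_le _ _).trans ?_
    exact (mul_le_of_le_one_left (norm_nonneg _) (norm_coordProj_le n)).trans
      (norm_transposeOp_le Y)
  refine ContinuousLinearMap.opNorm_le_bound _ (by positivity) fun x => ?_
  have h2 := key x (schurCorner m n Y x)
  rw [inner_self_eq_norm_sq_to_K, norm_pow, RCLike.norm_ofReal, abs_norm] at h2
  by_contra! h3
  have h4 : 0 < ‖schurCorner m n Y x‖ := lt_of_le_of_lt (by positivity) h3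
  nlinarith

theorem schurCorner_sub (m : ℕ → ℕ → ℂ) (n : ℕ) (Y Z : Op) :
    schurCorner m n (Y - Z) = schurCorner m n Y - schurCorner m n Z := by
  refine op_ext_entry fun i j => ?_
  have hsub : ∀ A B : Op, ∀ i j, entry (A - B) i j = entry A i j - entry B i j := fun A B i j => by
    simp [entry]
  rw [hsub, entry_schurCorner, entry_schurCorner, entry_schurCorner, hsub]
  split_ifs <;> ring

/-- Lets a difference of two corners be written as one corner of `A - corner n A`, which is small
for compact `A`. -/
theorem schurCorner_corner (m : ℕ → ℕ → ℂ) {n N : ℕ} (h : n ≤ N) (Y : Op) :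
    schurCorner m N (corner n Y) = schurCorner m n Y := by
  refine op_ext_entry fun i j => ?_
  rw [entry_schurCorner, entry_schurCorner, entry_corner]
  split_ifs <;> first | rfl | omega | simp

theorem isLinearBound_of_isRankOneTraceBound {m : ℕ → ℕ → ℂ} {C : ℝ} (hC : 0 ≤ C)
    (h : IsRankOneTraceBound m C) : IsLinearBound ∞ m C := by
  refine ⟨hC, fun A hA => ?_⟩
  rw [memSchatten_top_iff] at hA
  have hcorner : Tendsto (fun n => C * ‖A - corner n A‖) atTop (𝓝 0) := by
    have := (tendsto_iff_norm_sub_tendsto_zero.1 (tendsto_corner hA)).const_mul C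
    simpa [norm_sub_rev] using this
  have hcauchy : CauchySeq fun n => schurCorner m n A := by
    refine cauchySeq_of_le_tendsto_0' _ (fun n N hnN => ?_) hcorner
    rw [dist_comm, dist_eq_norm, ← schurCorner_corner m hnN, ← schurCorner_sub]
    exact norm_schurCorner_le hC h N _
  obtain ⟨T, hT⟩ := cauchySeq_tendsto_of_complete hcauchy
  refine ⟨T, memSchatten_top_iff.2 (isCompactOperator_of_tendsto hT
    (Eventually.of_forall fun n => isCompactOperator_schurCorner m n A)), fun i j => ?_, ?_⟩
  · refine tendsto_nhds_unique (((continuous_entry i j).tendsto T).comp hT)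
      (tendsto_const_nhds.congr' ?_)
    filter_upwards [eventually_gt_atTop (max i j)] with n hn
    rw [Function.comp_apply, entry_schurCorner, if_pos (by omega)]
  · rw [schattenNorm_top, schattenNorm_top]
    exact le_of_tendsto hT.norm (Eventually.of_forall fun n => norm_schurCorner_le hC h n A)

theorem isRankOneTraceBound_of_isBilinearBound {m : ℕ → ℕ → ℕ → ℂ} {C : ℝ}
    (h : IsBilinearBound 1 m C) (k : ℕ) : IsRankOneTraceBound (fun i j => m i k j) C := by
  intro x y
  -- Only the middle index `k` survives in the product; `star y` cancels the conjugation in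
  -- `rankOne`.
  obtain ⟨T, hT, hTe, hTn⟩ := h.2 (InnerProductSpace.rankOne ℂ x (stdVec k))
    (InnerProductSpace.rankOne ℂ (stdVec k) (star y))
    (by rw [memSchatten_two_iff, hsSq_rankOne]; exact ENNReal.ofReal_lt_top)
    (by rw [memSchatten_two_iff, hsSq_rankOne]; exact ENNReal.ofReal_lt_top)
  refine ⟨T, memSchatten_one_iff.1 hT, fun i j => ?_, ?_⟩
  · refine (hTe i j).unique ?_
    simp only [entry_rankOne, stdVec_apply, lp.star_apply]
    convert hasSum_ite_eq k (m i k j * (x i * y j)) using 2 with l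
    by_cases hl : l = k
    · subst hl
      simp
      ring
    · simp [hl]
  · simpa [schattenNorm_one, schattenNorm_two, hsSq_rankOne, norm_stdVec,
      ENNReal.toReal_ofReal, sq_nonneg, Real.sqrt_sq] using hTn

theorem isBilinearBound_one_iff {m : ℕ → ℕ → ℕ → ℂ} {C : ℝ} :
    IsBilinearBound 1 m C ↔ 0 ≤ C ∧ ∀ k, IsLinearBound ∞ (fun i j => m i k j) C :=
  ⟨fun h => ⟨h.1, fun k =>
    isLinearBound_of_isRankOneTraceBound h.1 (isRankOneTraceBound_of_isBilinearBound h k)⟩,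
    fun h => isBilinearBound_of_isLinearBound h.1 h.2⟩

/-! ### The norms -/

theorem linearSchurNorm_nonneg (p : ℝ≥0∞) (m : ℕ → ℕ → ℂ) : 0 ≤ linearSchurNorm p m :=
  Real.sInf_nonneg fun _ h => h.1

theorem isLinearBound_linearSchurNorm {m : ℕ → ℕ → ℂ} (h : IsLinearSchurMultiplier ∞ m) :
    IsLinearBound ∞ m (linearSchurNorm ∞ m) := by
  refine ⟨linearSchurNorm_nonneg _ _, fun A hA => ?_⟩
  obtain ⟨C, hC⟩ := h
  obtain ⟨T, hT, hTe, -⟩ := hC.2 A hA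
  refine ⟨T, hT, hTe, ?_⟩
  rw [schattenNorm_top, schattenNorm_top]
  have h1 : ∀ D, IsLinearBound ∞ m D → ‖T‖ ≤ D * ‖A‖ := fun D hD => by
    obtain ⟨T', -, hTe', hTn⟩ := hD.2 A hA
    -- The image is determined by its entries, so every admissible constant bounds the same `T` and
    -- the infimum is attained.
    have : T = T' := op_ext_entry fun i j => by rw [hTe, hTe']
    rwa [this, ← schattenNorm_top, ← schattenNorm_top A]
  rcases (norm_nonneg A).eq_or_lt with h0 | h0
  · simpa [← h0] using h1 C hC
  · rw [← div_le_iff₀ h0]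
    exact le_csInf ⟨C, hC⟩ fun D hD => (div_le_iff₀ h0).2 (h1 D hD)

theorem IsLinearBound.mono {m : ℕ → ℕ → ℂ} {C D : ℝ} (h : IsLinearBound ∞ m C) (hCD : C ≤ D) :
    IsLinearBound ∞ m D := by
  refine ⟨h.1.trans hCD, fun A hA => ?_⟩
  obtain ⟨T, hT, hTe, hTn⟩ := h.2 A hA
  refine ⟨T, hT, hTe, hTn.trans ?_⟩
  gcongr
  rw [schattenNorm_top]
  exact norm_nonneg A

theorem linearSchurNorm_le {p : ℝ≥0∞} {m : ℕ → ℕ → ℂ} {C : ℝ} (h : IsLinearBound p m C) :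
    linearSchurNorm p m ≤ C :=
  csInf_le ⟨0, fun _ h => h.1⟩ h

end SchurMult

end

theorem mainTheorem2 (m : ℕ → ℕ → ℕ → ℂ) :
    (SchurMult.IsBilinearSchurMultiplier 1 m ↔
      (∀ k, SchurMult.IsLinearSchurMultiplier ∞ (fun i j => m i k j)) ∧
        BddAbove (Set.range fun k => SchurMult.linearSchurNorm ∞ (fun i j => m i k j))) ∧
    (SchurMult.IsBilinearSchurMultiplier 1 m →
      SchurMult.bilinearSchurNorm 1 m =
        ⨆ k, SchurMult.linearSchurNorm ∞ (fun i j => m i k j)) := by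
  have hbdd : ∀ C, SchurMult.IsBilinearBound 1 m C →
      ∀ k, SchurMult.linearSchurNorm ∞ (fun i j => m i k j) ≤ C := fun C hC k =>
    SchurMult.linearSchurNorm_le ((SchurMult.isBilinearBound_one_iff.1 hC).2 k)
  -- Because each infimum is attained, the supremum is itself an admissible bound for every slice.
  have hsup : (∀ k, SchurMult.IsLinearSchurMultiplier ∞ (fun i j => m i k j)) →
      BddAbove (Set.range fun k => SchurMult.linearSchurNorm ∞ (fun i j => m i k j)) →
      SchurMult.IsBilinearBound 1 m (⨆ k, SchurMult.linearSchurNorm ∞ (fun i j => m i k j)) :=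
    fun h hb => SchurMult.isBilinearBound_one_iff.2
      ⟨Real.iSup_nonneg fun k => SchurMult.linearSchurNorm_nonneg _ _, fun k =>
        (SchurMult.isLinearBound_linearSchurNorm (h k)).mono (le_ciSup hb k)⟩
  have hiff : SchurMult.IsBilinearSchurMultiplier 1 m ↔
      (∀ k, SchurMult.IsLinearSchurMultiplier ∞ (fun i j => m i k j)) ∧
        BddAbove (Set.range fun k => SchurMult.linearSchurNorm ∞ (fun i j => m i k j)) := by
    refine ⟨fun ⟨C, hC⟩ => ⟨fun k => ⟨C, (SchurMult.isBilinearBound_one_iff.1 hC).2 k⟩, C, ?_⟩,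
      fun h => ⟨_, hsup h.1 h.2⟩⟩
    rintro _ ⟨k, rfl⟩
    exact hbdd C hC k
  refine ⟨hiff, fun h => le_antisymm ?_ ?_⟩
  · obtain ⟨h1, h2⟩ := hiff.1 h
    exact csInf_le ⟨0, fun _ h => h.1⟩ (hsup h1 h2)
  · exact le_csInf h fun C hC => ciSup_le (hbdd C hC)
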